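/- Let $T$ be an arbitrary complete first-order theory and $\mathbb{M}$ a monster model of $T$: it suffices that $\mathbb{M}$ is $\mu$-saturated for some $\mu>\aleph_0$. "Small" means of cardinality $<\mu$. Below, $C\subseteq\mathbb{M}$ is a small set, tuples are small (possibly infinite) tuples of elements of $\mathbb{M}$, and $\kappa_1,\kappa_2$ are small cardinals (possibly finite). An inp-pattern of depth $\kappa$ in a partial type $p(x)$ over $C$ consists of an array $(a_{\alpha,i})_{\alpha<\kappa,\,i<\omega}$ of finite tuples in $\mathbb{M}$, formulas $\varphi_\alpha(x,y_\alpha)$ without parameters and numbers $k_\alpha<\omega$ such that (i) for each $\alpha<\kappa$ the family $(\varphi_\alpha(x,a_{\alpha,i}))_{i<\omega}$ is $k_\alpha$-inconsistent, i.e. any $k_\alpha$ of its members with distinct indices $i$ are jointly inconsistent; (ii) for every $f:\kappa\to\omega$ the set $p(x)\cup\{\varphi_\alpha(x,a_{\alpha,f(\alpha)}):\alpha<\kappa\}$ is consistent. The burden $\operatorname{bdn}(p)$ is the supremum of the depths of all inp-patterns in $p$, and $\operatorname{bdn}(a/C):=\operatorname{bdn}(\operatorname{tp}(a/C))$. (1)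 If there is an inp-pattern of depth $\kappa_1\times\kappa_2$ in $\operatorname{tp}(b_1b_2/C)$, then there is an inp-pattern of depth $\kappa_1$ in $\operatorname{tp}(b_1/C)$ or an inp-pattern of depth $\kappa_2$ in $\operatorname{tp}(b_2/b_1C)$. (2) (Sub-multiplicativity of burden.) If $n\in\omega$, $k_0,\dots,k_{n-1}\in\omega$ and $\operatorname{bdn}(a_i/C)<k_i$ for all $i<n$, then $\operatorname{bdn}(a_0\dots a_{n-1}/C)<\prod_{i<n}k_i$; in particular (for $C=\emptyset$) $\operatorname{bdn}(a_i)<k_i$ for all $i<n$ implies $\operatorname{bdn}(a_0\dots a_{n-1})<\prod_{i<n}k_i$. -/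

import Mathlib

open FirstOrder FirstOrder.Language Cardinal

universe u v w x

namespace Burden

/-- `M` is `μ`-saturated: every set of formulas in one variable with parameters in a subset of `M`
of cardinality `< μ` which is finitely satisfiable in `M` is realized in `M`. -/
def IsSaturated (L : FirstOrder.Language.{u, v}) (M : Type w) [L.Structure M] (μ : Cardinal.{w}) : Prop :=
  ∀ A : Set M, #A < μ → ∀ Γ : Set (L[[A]].Formula Unit),
    (∀ Γ₀ : Finset (L[[A]].Formula Unit), (Γ₀ : Set (L[[A]].Formula Unit)) ⊆ Γ →
      ∃ c : Unit → M, ∀ ψ ∈ Γ₀, ψ.Realize c) →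
    ∃ c : Unit → M, ∀ ψ ∈ Γ, ψ.Realize c

/-- The complete type `tp(b/C)` of a (possibly infinite) tuple `b` over a set `C`. -/
def tp (L : FirstOrder.Language.{u, v}) {M : Type w} [L.Structure M] {ι : Type x} (b : ι → M) (C : Set M) :
    Set (L[[C]].Formula ι) :=
  {ψ | ψ.Realize b}

/-- The rows `(a α i)_{i < ω}`, formulas `φ α (x, y_α)` and numbers `k α`, for `α` in `I`, form an
inp-pattern in the partial type `p(x)` over `C`: each family `(φ α (x, a α i))_{i < ω}` is
`k α`-inconsistent (no `k α` members with pairwise distinct indices have a common solution), and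
`{φ α (x, a α (f α)) | α ∈ I} ∪ p(x)` is consistent (finitely satisfiable in `M`) for every `f`. -/
structure IsInpPattern {L : FirstOrder.Language.{u, v}} {M : Type w} [L.Structure M] {ι : Type x} {C : Set M}
    (p : Set (L[[C]].Formula ι)) {I : Type w} {m : I → ℕ}
    (φ : ∀ α, L.Formula (ι ⊕ Fin (m α))) (k : I → ℕ) (a : ∀ α, ℕ → Fin (m α) → M) : Prop where
  inconsistent : ∀ (α : I) (s : Finset ℕ), s.card = k α →
    ¬ ∃ b : ι → M, ∀ i ∈ s, (φ α).Realize (Sum.elim b (a α i))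
  consistent : ∀ (f : I → ℕ) (s : Finset I) (q : Finset (L[[C]].Formula ι)),
    (q : Set (L[[C]].Formula ι)) ⊆ p →
    ∃ b : ι → M, (∀ α ∈ s, (φ α).Realize (Sum.elim b (a α (f α)))) ∧ ∀ ψ ∈ q, ψ.Realize b

/-- There is an inp-pattern of depth `κ` in `p`. -/
def HasInpPattern {L : FirstOrder.Language.{u, v}} {M : Type w} [L.Structure M] {ι : Type x} {C : Set M}
    (p : Set (L[[C]].Formula ι)) (κ : Cardinal.{w}) : Prop :=
  ∃ I : Type w, #I = κ ∧ ∃ (m : I → ℕ) (φ : ∀ α, L.Formula (ι ⊕ Fin (m α))) (k : I → ℕ)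
    (a : ∀ α, ℕ → Fin (m α) → M), IsInpPattern p φ k a

/-- The burden of `p`: the supremum of the depths of all inp-patterns in `p`, computed among the
cardinals with a top element `∞` added, so that the supremum always exists. -/
noncomputable def bdn {L : FirstOrder.Language.{u, v}} {M : Type w} [L.Structure M] {ι : Type x} {C : Set M}
    (p : Set (L[[C]].Formula ι)) : WithTop Cardinal.{w} :=
  sSup {d | ∃ κ : Cardinal.{w}, HasInpPattern p κ ∧ d = (κ : WithTop Cardinal.{w})}

end Burden

/-! Arrange the rows of a pattern in `tp(b₁b₂/C)` as a grid indexed by `I₁ × I₂`, and make the rows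
mutually indiscernible over `C` (`exists_indiscernible_pattern`). Try to select one row from each
column `{(α, β) | α}` so that finite parts of `tp(b₁b₂/C)` allow one value `x₁` of the first part
that is consistent with any finite set of paths through the selected rows, where `x₂` may depend on
the path.

By Zorn there is a maximal partial selection. If it misses a column `β`, each row `(α, β)` fails to
extend it, and a finite witness of this failure gives a formula in `x₁` alone. A path meets row `(α,
β)` in one entry, so the formula can be instantiated at single entries of that row. Too many
instances holding at one `x₁` would give back, by indiscernibility, the consistency that fails,
while the selection already made keeps the instances for different `α` jointly consistent. This is a
pattern indexed by `I₁` in `tp(b₁/C)` (`hasInpPattern_or_exists_selection`).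

If the selection is total, saturation moves the array so that `b₁` itself takes the place of `x₁`.
The selected rows, with `b₁` as a parameter, form a pattern in `tp(b₂/b₁C)`
(`hasInpPattern_of_selection`).

Sub-multiplicativity follows by induction on the number of tuples, because patterns over a larger
set are patterns over `C` and a burden below a natural number `k` means that depth `k` does not
occur. -/

namespace Burden

/-! ### Definable sets in possibly infinitely many variables. -/

section Definability

variable {L : FirstOrder.Language.{u, v}} {M : Type w} [L.Structure M] {A : Set M}
  {α β γ : Type*}

/-- A definable set is the preimage of a definable set in finitely many variables. -/
theorem exists_finset_support {D : Set (α → M)} (hD : A.Definable L D) :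
    ∃ (T : Finset α) (E : Set (T → M)), A.Definable L E ∧ D = {z | (fun t : T => z t) ∈ E} := by
  classical
  obtain ⟨φ, rfl⟩ := hD
  refine ⟨φ.freeVarFinset, {z | Formula.Realize (φ.restrictFreeVar id) z}, ⟨_, rfl⟩, ?_⟩
  ext z
  exact (BoundedFormula.realize_restrictFreeVar (φ := φ) (f := id) (v := fun a => z a)
    (v' := z) (fun _ => rfl)).symm

/-- Membership in a definable set depends on finitely many coordinates only. -/
theorem exists_finset_dependsOn {D : Set (α → M)} (hD : A.Definable L D) :
    ∃ T : Finset α, ∀ z z' : α → M, (∀ t ∈ T, z t = z' t) → (z ∈ D ↔ z' ∈ D) := by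
  obtain ⟨T, E, -, rfl⟩ := exists_finset_support hD
  refine ⟨T, fun z z' h => ?_⟩
  have : (fun t : T => z t) = fun t : T => z' t := funext fun t => h t t.2
  simp [this]

theorem definable_realize (ψ : L.Formula γ) (h : γ → β) :
    A.Definable L {z : β → M | ψ.Realize fun j => z (h j)} := by
  have h₀ : (∅ : Set M).Definable L {z : γ → M | ψ.Realize z} :=
    Set.empty_definable_iff.2 ⟨ψ, rfl⟩
  exact (h₀.mono (Set.empty_subset A)).preimage_comp h

/-- Definability is preserved by existential quantification over a possibly infinite tuple. -/
theorem definable_exists [Nonempty M] {P : (α → M) → (β → M) → Prop}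
    (hP : A.Definable L {z : α ⊕ β → M | P (z ∘ Sum.inl) (z ∘ Sum.inr)}) :
    A.Definable L {z : α → M | ∃ y : β → M, P z y} := by
  classical
  obtain ⟨T, E, hE, hTE⟩ := exists_finset_support hP
  let T₂ := T.toRight
  let h : T → α ⊕ T₂ := fun t => Sum.casesOn (motive := fun s => s ∈ T → α ⊕ T₂) t.1
    (fun a _ => Sum.inl a) (fun b hb => Sum.inr ⟨b, by simpa [T₂] using hb⟩) t.2
  have key : ∀ (z : α → M) (y : β → M), P z y ↔
      (fun t => Sum.elim z (fun b : T₂ => y b) (h t)) ∈ E := by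
    intro z y
    have := Set.ext_iff.1 hTE (Sum.elim z y)
    simp only [Set.mem_ofPred_eq, Sum.elim_comp_inl, Sum.elim_comp_inr] at this
    rw [this]
    have e : (fun t : T => Sum.elim z y t) = fun t => Sum.elim z (fun b : T₂ => y b) (h t) := by
      funext t
      rcases t with ⟨a | b, ht⟩ <;> rfl
    rw [e]
  have hex := (hE.preimage_comp h).exists_of_finite
  convert hex using 1
  ext z
  constructor
  · rintro ⟨y, hy⟩
    exact ⟨fun b => y b, (key z y).1 hy⟩
  · rintro ⟨y, hy⟩
    refine ⟨fun b => if hb : b ∈ T₂ then y ⟨b, hb⟩ else Classical.arbitrary M, (key _ _).2 ?_⟩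
    have e : (fun b : T₂ => if hb : (b : β) ∈ T₂ then y ⟨b, hb⟩ else Classical.arbitrary M) = y :=
      funext fun b => by simp
    rw [e]
    exact hy

theorem definable_and {P Q : (α → M) → Prop} (hP : A.Definable L {z | P z})
    (hQ : A.Definable L {z | Q z}) : A.Definable L {z | P z ∧ Q z} :=
  hP.inter hQ

theorem definable_not {P : (α → M) → Prop} (hP : A.Definable L {z | P z}) :
    A.Definable L {z | ¬ P z} :=
  hP.compl

theorem definable_forall_mem_finset {κ : Type*} (s : Finset κ) {P : κ → (α → M) → Prop}
    (hP : ∀ i, A.Definable L {z | P i z}) : A.Definable L {z | ∀ i ∈ s, P i z} := by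
  convert Set.definable_biInter_finset hP s using 1
  ext z
  simp

/-- Substituting a tuple for some of the variables adds it to the parameters. -/
theorem definable_subst {P : (α → M) → (β → M) → Prop} (b : α → M)
    (hP : A.Definable L {z : α ⊕ β → M | P (z ∘ Sum.inl) (z ∘ Sum.inr)}) :
    (Set.range b ∪ A).Definable L {y : β → M | P b y} := by
  obtain ⟨φ, hφ⟩ := Set.definable_iff_exists_formula_sum.1 hP
  refine Set.definable_iff_exists_formula_sum.2
    ⟨φ.relabel (Sum.elim (fun a : A => Sum.inl ⟨a, Or.inr a.2⟩)
      (Sum.elim (fun i => Sum.inl ⟨b i, Or.inl ⟨i, rfl⟩⟩) Sum.inr)), ?_⟩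
  ext y
  have := Set.ext_iff.1 hφ (Sum.elim b y)
  simp only [Set.mem_ofPred_eq, Sum.elim_comp_inl, Sum.elim_comp_inr] at this
  simp only [Set.mem_ofPred_eq, Formula.realize_relabel]
  rw [this]
  apply iff_of_eq
  congr 1
  funext s
  rcases s with a | a | a <;> rfl

theorem definable_apply_eq (i : α) {t : M} (ht : t ∈ A) :
    A.Definable L {z : α → M | z i = t} :=
  ⟨(Term.var i).equal (L.con (⟨t, ht⟩ : A)).term, by ext z; simp⟩

theorem definable_apply_eq_apply (i j : α) : A.Definable L {z : α → M | z i = z j} :=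
  ⟨(Term.var i).equal (Term.var j), by ext z; simp⟩

end Definability

/-! ### Saturation for types in fewer than `μ` variables. -/

section Saturation

variable {L : FirstOrder.Language.{u, v}} {M : Type w} [L.Structure M]
  {μ : Cardinal.{w}}

theorem IsSaturated.exists_forall_mem_unit (hM : IsSaturated L M μ) {A : Set M} (hA : #A < μ)
    {J : Type*} (D : J → Set (Unit → M)) (hD : ∀ j, A.Definable L (D j))
    (hfin : ∀ s : Finset J, ∃ c, ∀ j ∈ s, c ∈ D j) : ∃ c, ∀ j, c ∈ D j := by
  classical
  choose φ hφ using hD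
  obtain ⟨c, hc⟩ := hM A hA (Set.range φ) fun Γ₀ hΓ => by
    choose g hg using fun ψ : Γ₀ => hΓ ψ.2
    obtain ⟨c, hc⟩ := hfin (Γ₀.attach.image g)
    refine ⟨c, fun ψ hψ => ?_⟩
    have := hc (g ⟨ψ, hψ⟩) (Finset.mem_image_of_mem _ (Finset.mem_attach _ _))
    rw [hφ, hg] at this
    exact this
  refine ⟨c, fun j => ?_⟩
  rw [hφ j]
  exact hc _ ⟨j, rfl⟩

/-- In a `μ`-saturated structure, a finitely satisfiable family of definable sets in fewer than
`μ` variables over fewer than `μ` parameters has a common point. -/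
theorem IsSaturated.exists_forall_mem [Nonempty M] (hM : IsSaturated L M μ) (hμ : ℵ₀ ≤ μ) {A : Set M}
    (hA : #A < μ) {V : Type w} (hV : #V < μ) {J : Type*} (D : J → Set (V → M))
    (hD : ∀ j, A.Definable L (D j))
    (hfin : ∀ s : Finset J, ∃ z, ∀ j ∈ s, z ∈ D j) : ∃ z, ∀ j, z ∈ D j := by
  classical
  -- Members are graphs of partial assignments that are finitely consistent with all `D j`; a
  -- maximal one will be the graph of a total function.
  let good : Set (Set (V × M)) := {H | ∀ (s : Finset J) (K : Finset (V × M)), ↑K ⊆ H →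
    ∃ z : V → M, (∀ j ∈ s, z ∈ D j) ∧ ∀ e ∈ K, z e.1 = e.2}
  obtain ⟨H, hH⟩ : ∃ H, Maximal (· ∈ good) H := by
    refine zorn_subset good fun c hc hchain => ?_
    rcases c.eq_empty_or_nonempty with rfl | hne
    · refine ⟨∅, fun s K hK => ?_, by simp⟩
      obtain ⟨z, hz⟩ := hfin s
      refine ⟨z, hz, fun e he => (hK he).elim⟩
    · refine ⟨⋃₀ c, fun s K hK => ?_, fun t ht => Set.subset_sUnion_of_mem ht⟩
      obtain ⟨t, htc, hKt⟩ := hchain.directedOn.exists_mem_subset_of_finset_subset_biUnion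
        (f := id) hne (s := K) (by simpa [Set.sUnion_eq_biUnion] using hK)
      exact hc htc s K hKt
  have hfun : ∀ i t t', (i, t) ∈ H → (i, t') ∈ H → t = t' := by
    intro i t t' h h'
    obtain ⟨z, -, hz⟩ := hH.prop ∅ {(i, t), (i, t')} (by
      intro e he
      simp only [Finset.coe_insert, Finset.coe_singleton, Set.mem_insert_iff,
        Set.mem_singleton_iff] at he
      rcases he with rfl | rfl <;> assumption)
    exact (hz (i, t) (by simp)).symm.trans (hz (i, t') (by simp))
  let A' : Set M := A ∪ Prod.snd '' H
  have hA' : #A' < μ := by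
    have hHV : #H ≤ #V := mk_le_of_injective (f := fun e : H => e.1.1) fun e e' h => by
      rcases e with ⟨⟨i, t⟩, he⟩
      rcases e' with ⟨⟨i', t'⟩, he'⟩
      obtain rfl : i = i' := h
      simp [hfun i t t' he he']
    exact (mk_union_le _ _).trans_lt
      (add_lt_of_lt hμ hA ((mk_image_le.trans hHV).trans_lt hV))
  have htot : ∀ i, ∃ t, (i, t) ∈ H := by
    intro i
    let KH := {K : Finset (V × M) // (K : Set (V × M)) ⊆ H}
    -- The possible values at `i` form a type in one variable: project the constraints to coordinate
    -- `i`, with the values already assigned as parameters.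
    have hex := hM.exists_forall_mem_unit hA'
      (fun q : Finset J × KH => {c : Unit → M | ∃ z : V → M,
        ((∀ j ∈ q.1, z ∈ D j) ∧ ∀ e ∈ q.2.1.attach, z e.1.1 = e.1.2) ∧ z i = c ()})
      (fun q => by
        refine definable_exists (definable_and (definable_and ?_ ?_) ?_)
        · exact definable_forall_mem_finset _ fun j =>
            ((hD j).mono Set.subset_union_left).preimage_comp Sum.inr
        · exact definable_forall_mem_finset _ fun e =>
            definable_apply_eq (Sum.inr e.1.1) (Or.inr ⟨e.1, q.2.2 e.2, rfl⟩)
        · exact definable_apply_eq_apply (Sum.inr i) (Sum.inl ()))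
      (fun s => by
        obtain ⟨z, hz, hzK⟩ := hH.prop (s.biUnion Prod.fst) (s.biUnion fun q => q.2.1) (by
          intro e he
          simp only [Finset.coe_biUnion, Set.mem_iUnion] at he
          obtain ⟨q, -, he⟩ := he
          exact q.2.2 he)
        refine ⟨fun _ => z i, fun q hq => ⟨z, ⟨fun j hj => hz j ?_, fun e _ => hzK e.1 ?_⟩, rfl⟩⟩
        · exact Finset.mem_biUnion.2 ⟨q, hq, hj⟩
        · exact Finset.mem_biUnion.2 ⟨q, hq, e.2⟩)
    obtain ⟨c, hc⟩ := hex
    refine ⟨c (), hH.le_of_ge (y := insert (i, c ()) H) ?_ (Set.subset_insert _ _)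
      (Set.mem_insert _ _)⟩
    intro s K hK
    obtain ⟨z, ⟨hz, hzK⟩, hzi⟩ := hc (s, ⟨K.erase (i, c ()), fun e he => by
      have he := Finset.mem_erase.1 (Finset.mem_coe.1 he)
      exact (hK he.2).resolve_left he.1⟩)
    refine ⟨z, hz, fun e he => ?_⟩
    by_cases h : e = (i, c ())
    · rw [h]
      exact hzi
    · exact hzK ⟨e, Finset.mem_erase.2 ⟨h, he⟩⟩ (Finset.mem_attach _ _)
  choose z hz using htot
  refine ⟨z, fun j => ?_⟩
  obtain ⟨T, hT⟩ := exists_finset_dependsOn (hD j)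
  obtain ⟨z', hz', hz'T⟩ := hH.prop {j} (T.image fun i => (i, z i)) (by
    intro e he
    simp only [Finset.coe_image, Set.mem_image] at he
    obtain ⟨i, -, rfl⟩ := he
    exact hz i)
  refine (hT z' z fun i hi => ?_).1 (hz' j (by simp))
  exact hz'T (i, z i) (Finset.mem_image_of_mem _ hi)

end Saturation

end Burden

namespace Burden

/-! ### Iterated ultrafilter quantifiers, used in place of Ramsey's theorem. -/

section IteratedUltrafilter

open Filter

variable {ι : Type*} [DecidableEq ι]

/-- The iterated quantifier `∀ᶠ i₁, ∀ᶠ i₂, …` along a nonprincipal ultrafilter on `ℕ`, where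
`i₁, i₂, …` are the new values of `v` at the members of a list. -/
def IterEventually : List ι → ((ι → ℕ) → Prop) → (ι → ℕ) → Prop
  | [], P, v => P v
  | x :: l, P, v => ∀ᶠ i in (hyperfilter ℕ : Filter ℕ), IterEventually l P (Function.update v x i)

theorem iterEventually_not (l : List ι) (P : (ι → ℕ) → Prop) (v : ι → ℕ) :
    IterEventually l (fun v => ¬ P v) v ↔ ¬ IterEventually l P v := by
  induction l generalizing v with
  | nil => rfl
  | cons x l ih =>
    simp only [IterEventually, ih]
    exact Ultrafilter.eventually_not

theorem iterEventually_forall_mem {κ : Type*} (s : Finset κ) (l : List ι)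
    (P : κ → (ι → ℕ) → Prop) (v : ι → ℕ) :
    IterEventually l (fun v => ∀ j ∈ s, P j v) v ↔ ∀ j ∈ s, IterEventually l (P j) v := by
  induction l generalizing v with
  | nil => rfl
  | cons x l ih =>
    simp only [IterEventually, ih]
    exact eventually_all_finset s

theorem iterEventually_congr {P : (ι → ℕ) → Prop} {S : Finset ι}
    (hP : ∀ v v', (∀ x ∈ S, v x = v' x) → (P v ↔ P v')) (l : List ι) (v v' : ι → ℕ)
    (h : ∀ x ∈ S, x ∉ l → v x = v' x) : IterEventually l P v ↔ IterEventually l P v' := by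
  induction l generalizing v v' with
  | nil => exact hP _ _ (by simpa using h)
  | cons y l ih =>
    refine eventually_congr (Eventually.of_forall fun i => ih _ _ fun x hx hxl => ?_)
    by_cases hxy : x = y
    · simp [hxy]
    · simpa [hxy] using h x hx (by simp [hxy, hxl])

/-- A quantifier over a coordinate on which `P` does not depend is vacuous, since the ultrafilter is
proper. -/
theorem iterEventually_filter {P : (ι → ℕ) → Prop} {S : Finset ι}
    (hP : ∀ v v', (∀ x ∈ S, v x = v' x) → (P v ↔ P v')) (l : List ι) (v : ι → ℕ) :
    IterEventually (l.filter (· ∈ S)) P v ↔ IterEventually l P v := by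
  induction l generalizing v with
  | nil => rfl
  | cons y l ih =>
    by_cases hy : y ∈ S
    · simp only [List.filter_cons, hy, decide_true, if_true, IterEventually, ih]
    · simp only [List.filter_cons, hy, decide_false, Bool.false_eq_true, if_false, IterEventually,
        ih]
      have : ∀ i, IterEventually l P (Function.update v y i) ↔ IterEventually l P v := fun i =>
        iterEventually_congr hP l _ _ fun x hx _ =>
          Function.update_of_ne (ne_of_mem_of_not_mem hx hy) _ _
      simp [this]

/-- A nonprincipal ultrafilter contains every cofinite set, so each new value can be taken above all
previous ones. -/
theorem IterEventually.exists_injOn {P : (ι → ℕ) → Prop} {l : List ι} (hl : l.Nodup)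
    {v : ι → ℕ} (h : IterEventually l P v) (N : ℕ) :
    ∃ v', P v' ∧ (∀ x ∈ l, N < v' x) ∧ (∀ x ∉ l, v' x = v x) ∧
      ∀ x ∈ l, ∀ y ∈ l, v' x = v' y → x = y := by
  induction l generalizing v N with
  | nil => exact ⟨v, h, by simp⟩
  | cons x l ih =>
    rw [List.nodup_cons] at hl
    have hN : ∀ᶠ i in (hyperfilter ℕ : Filter ℕ), N < i :=
      (Nat.cofinite_eq_atTop ▸ hyperfilter_le_cofinite) (eventually_gt_atTop N)
    obtain ⟨i, hi, hNi⟩ := (Eventually.and h hN).exists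
    obtain ⟨v', hPv', hlt, hout, hinj⟩ := ih hl.2 hi i
    have hx : v' x = i := by simpa using hout x hl.1
    refine ⟨v', hPv', ?_, ?_, ?_⟩
    · intro y hy
      rcases List.mem_cons.1 hy with rfl | hy
      · omega
      · exact hNi.trans (hlt y hy)
    · intro y hy
      rw [List.mem_cons, not_or] at hy
      rw [hout y hy.2, Function.update_of_ne hy.1]
    · intro y hy y' hy' e
      rcases List.mem_cons.1 hy with rfl | hyl <;> rcases List.mem_cons.1 hy' with rfl | hyl'
      · rfl
      · have := hlt _ hyl'
        omega
      · have := hlt _ hyl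
        omega
      · exact hinj _ hyl _ hyl' e

theorem iterEventually_map {σ : ι → ι} (hσ : Function.Injective σ) (P : (ι → ℕ) → Prop)
    (l : List ι) (v : ι → ℕ) :
    IterEventually (l.map σ) (fun v => P (v ∘ σ)) v ↔ IterEventually l P (v ∘ σ) := by
  induction l generalizing v with
  | nil => rfl
  | cons x l ih =>
    simp only [List.map_cons, IterEventually, ih, Function.update_comp_eq_of_injective _ hσ]

end IteratedUltrafilter

section SortedUltrafilter

variable {ι : Type*} [LinearOrder ι]

/-- The iterated ultrafilter quantifier over a finite set of indices in increasing order. -/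
def SortEventually (S : Finset ι) (P : (ι → ℕ) → Prop) : Prop :=
  IterEventually (S.sort (· ≤ ·)) P 0

theorem sortEventually_of_subset {P : (ι → ℕ) → Prop} {S T : Finset ι} (hST : S ⊆ T)
    (hP : ∀ v v', (∀ x ∈ S, v x = v' x) → (P v ↔ P v')) :
    SortEventually T P ↔ SortEventually S P := by
  have : (T.sort (· ≤ ·)).filter (· ∈ S) = S.sort (· ≤ ·) := by
    refine List.Perm.eq_of_pairwise' (r := (· ≤ ·)) ((T.pairwise_sort (· ≤ ·)).filter _)
      (S.pairwise_sort (· ≤ ·)) ?_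
    refine (List.perm_ext_iff_of_nodup ((T.sort_nodup _).filter _) (S.sort_nodup _)).2 fun x => ?_
    simpa using fun h => hST h
  rw [SortEventually, SortEventually, ← this, iterEventually_filter hP]

theorem sortEventually_image {σ : ι → ι} (hσ : StrictMono σ) (P : (ι → ℕ) → Prop)
    (S : Finset ι) :
    SortEventually (S.image σ) (fun v => P (v ∘ σ)) ↔ SortEventually S P := by
  have : (S.image σ).sort (· ≤ ·) = (S.sort (· ≤ ·)).map σ := by
    refine List.Perm.eq_of_pairwise' (r := (· ≤ ·)) ((S.image σ).pairwise_sort (· ≤ ·))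
      ((S.pairwise_sort (· ≤ ·)).map σ fun _ _ h => hσ.monotone h) ?_
    refine (List.perm_ext_iff_of_nodup (Finset.sort_nodup _ _)
      ((S.sort_nodup _).map hσ.injective)).2 fun x => ?_
    simp
  rw [SortEventually, SortEventually, this, iterEventually_map hσ.injective]
  rfl

end SortedUltrafilter

/-! ### Arrays with mutually indiscernible rows. -/

section Indiscernible

variable {L : FirstOrder.Language.{u, v}} {M : Type w} [L.Structure M] [Nonempty M]
  {μ : Cardinal.{w}}

/-- The array whose row `r` has the entries of row `r` of `a` listed by `v r`; the components of
the tuples in row `r` are the `c` with `row c = r`. -/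
def reindex {W R : Type*} (row : W → R) (v : R → ℕ → ℕ) (a : W × ℕ → M) : W × ℕ → M :=
  fun e => a (e.1, v (row e.1) e.2)

/-- Every array can be replaced by one with mutually indiscernible rows over a small set `A`,
which has all `A`-definable properties shared by the arrays obtained from `a` by reindexing the
rows injectively on a finite set of indices. -/
theorem IsSaturated.exists_mutually_indiscernible (hM : IsSaturated L M μ) (hμ : ℵ₀ ≤ μ)
    {A : Set M} (hA : #A < μ) {W R : Type w} (hW : #(W × ℕ) < μ) (row : W → R) (a : W × ℕ → M) :
    ∃ z : W × ℕ → M,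
      (∀ D : Set (W × ℕ → M), A.Definable L D → ∀ S : Finset (R × ℕ),
        (∀ v : R → ℕ → ℕ, (∀ r i j, (r, i) ∈ S → (r, j) ∈ S → v r i = v r j → i = j) →
          reindex row v a ∈ D) → z ∈ D) ∧
      ∀ D : Set (W × ℕ → M), A.Definable L D → ∀ v : R → ℕ → ℕ, (∀ r, StrictMono (v r)) →
        (reindex row v z ∈ D ↔ z ∈ D) := by
  classical
  -- Any linear order on the rows serves; it only fixes the order of the quantifiers. Reindexing
  -- each row increasingly then preserves the lexicographic order.
  let _ : LinearOrder R := linearOrderOfSTO (WellOrderingRel (α := R))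
  let arr (v : R ×ₗ ℕ → ℕ) : W × ℕ → M := reindex row (fun r i => v (toLex (r, i))) a
  let Dep (D : Set (W × ℕ → M)) (S : Finset (R ×ₗ ℕ)) : Prop :=
    ∀ v v' : R ×ₗ ℕ → ℕ, (∀ x ∈ S, v x = v' x) → (arr v ∈ D ↔ arr v' ∈ D)
  have hDep : ∀ D : Set (W × ℕ → M), A.Definable L D → ∃ S, Dep D S := by
    intro D hD
    obtain ⟨T, hT⟩ := exists_finset_dependsOn hD
    refine ⟨T.image fun e => toLex (row e.1, e.2), fun v v' h => hT _ _ fun e he => ?_⟩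
    have := h _ (Finset.mem_image_of_mem _ he)
    simp only [arr, reindex, this]
  have hmono : ∀ D S T, Dep D S → S ⊆ T → Dep D T :=
    fun D S T h hST v v' hv => h v v' fun x hx => hv x (hST hx)
  let J := {D : Set (W × ℕ → M) // A.Definable L D ∧
    ∃ S, Dep D S ∧ SortEventually S fun v => arr v ∈ D}
  obtain ⟨z, hz⟩ := hM.exists_forall_mem hμ hA hW (fun D : J => D.1) (fun D => D.2.1) (by
    intro s
    choose S hS using fun D : J => D.2.2
    have h : SortEventually (s.biUnion S) fun v => ∀ D ∈ s, arr v ∈ D.1 := by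
      refine (iterEventually_forall_mem s _ (fun (D : J) v => arr v ∈ D.1) _).2 fun D hD => ?_
      exact (sortEventually_of_subset (Finset.subset_biUnion_of_mem S hD) (hS D).1).2 (hS D).2
    obtain ⟨v, hv, -⟩ := IterEventually.exists_injOn (Finset.sort_nodup _ _) h 0
    exact ⟨arr v, hv⟩)
  -- The iterated quantifier commutes with negation, so `z` realizes a complete type and the
  -- converse follows by passing to complements.
  have hmem : ∀ D, A.Definable L D → ∀ S, Dep D S →
      (z ∈ D ↔ SortEventually S fun v => arr v ∈ D) := by
    intro D hD S hS
    refine ⟨fun h => ?_, fun h => hz ⟨D, hD, S, hS, h⟩⟩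
    by_contra hnot
    refine hz ⟨Dᶜ, hD.compl, S, fun v v' hv => not_congr (hS v v' hv), ?_⟩ h
    exact (iterEventually_not _ (fun v => arr v ∈ D) _).2 hnot
  refine ⟨z, fun D hD S hS => ?_, fun D hD v hv => ?_⟩
  · obtain ⟨S', hS'⟩ := hDep D hD
    have hT := hmono D S' (S' ∪ S.image toLex) hS' Finset.subset_union_left
    rw [hmem D hD _ hT]
    by_contra hnot
    have hnot := (iterEventually_not _ (fun v => arr v ∈ D) _).2 hnot
    obtain ⟨v, hv, -, -, hinj⟩ := IterEventually.exists_injOn (Finset.sort_nodup _ _) hnot 0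
    refine hv (hS _ fun r i j hi hj h => ?_)
    have := hinj (toLex (r, i)) (by simp [hi]) (toLex (r, j)) (by simp [hj]) h
    simpa using this
  · let σ : R ×ₗ ℕ → R ×ₗ ℕ := fun x => toLex ((ofLex x).1, v (ofLex x).1 (ofLex x).2)
    have hσ : StrictMono σ := by
      intro x y hxy
      rw [Prod.Lex.lt_iff] at hxy ⊢
      rcases hxy with h | ⟨h, h'⟩
      · exact Or.inl h
      · refine Or.inr ⟨h, ?_⟩
        simp only [σ, ofLex_toLex]
        rw [h]
        exact hv _ h'
    obtain ⟨S, hS⟩ := hDep D hD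
    have hS' : Dep {z | reindex row v z ∈ D} (S.image σ) := by
      intro u u' h
      exact hS (u ∘ σ) (u' ∘ σ) fun x hx => h _ (Finset.mem_image_of_mem _ hx)
    have hD' : A.Definable L {z | reindex row v z ∈ D} :=
      hD.preimage_comp fun e : W × ℕ => (e.1, v (row e.1) e.2)
    have h₁ := hmem _ hD' _ hS'
    rw [hmem D hD S hS, ← sortEventually_image hσ]
    exact h₁

end Indiscernible

end Burden

namespace Burden

/-! ### Patterns described by definable sets instead of formulas. -/

section Patterns

variable {L : FirstOrder.Language.{u, v}} {M : Type w} [L.Structure M] {A C : Set M}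

/-- The sets in the sequence `X` are defined by instances of a single formula. -/
def UniformlyDefinable (L : FirstOrder.Language.{u, v}) {M : Type w} [L.Structure M] {ι : Type*}
    (X : ℕ → Set (ι → M)) : Prop :=
  ∃ (m : ℕ) (φ : L.Formula (ι ⊕ Fin m)) (e : ℕ → Fin m → M),
    ∀ i x, x ∈ X i ↔ φ.Realize (Sum.elim x (e i))

theorem uniformlyDefinable_of_definable [Nonempty M] {ι β : Type*}
    {P : (ι → M) → (β → M) → Prop}
    (hP : A.Definable L {z : ι ⊕ β → M | P (z ∘ Sum.inl) (z ∘ Sum.inr)}) (e : ℕ → β → M) :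
    UniformlyDefinable L fun i => {x | P x (e i)} := by
  classical
  obtain ⟨φ, hφ⟩ := Set.definable_iff_exists_formula_sum.1 hP
  let T := φ.freeVarFinset
  let E := Fintype.equivFin T
  let h : T → ι ⊕ Fin (Fintype.card T) := fun t =>
    Sum.elim (fun _ => Sum.inr (E t)) (Sum.elim Sum.inl fun _ => Sum.inr (E t)) t.1
  -- Every free variable gets a parameter slot; the slots of the variables from `ι` are never read
  -- and hold an arbitrary element.
  refine ⟨_, φ.restrictFreeVar h, fun i j => Sum.elim (fun a : A => (a : M))
    (Sum.elim (fun _ => Classical.arbitrary M) (e i)) (E.symm j).1, fun i x => ?_⟩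
  have h₁ := Set.ext_iff.1 hφ (Sum.elim x (e i))
  simp only [Set.mem_ofPred_eq, Sum.elim_comp_inl, Sum.elim_comp_inr] at h₁
  rw [Set.mem_ofPred_eq, h₁]
  refine (BoundedFormula.realize_restrictFreeVar _ fun t => ?_).symm
  rcases t with ⟨a | a | a, ht⟩ <;> simp [h]

/-- A complete type is closed under finite conjunctions, so one definable set containing `b` stands
for a finite part of the type. -/
theorem isInpPattern_tp_iff {ι : Type x} {b : ι → M} {I : Type w} {m : I → ℕ}
    {φ : ∀ α, L.Formula (ι ⊕ Fin (m α))} {k : I → ℕ} {a : ∀ α, ℕ → Fin (m α) → M} :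
    IsInpPattern (tp L b C) φ k a ↔
      (∀ (α : I) (s : Finset ℕ), s.card = k α →
        ¬ ∃ x : ι → M, ∀ i ∈ s, (φ α).Realize (Sum.elim x (a α i))) ∧
      ∀ (f : I → ℕ) (s : Finset I) (D : Set (ι → M)), C.Definable L D → b ∈ D →
        ∃ x ∈ D, ∀ α ∈ s, (φ α).Realize (Sum.elim x (a α (f α))) := by
  constructor
  · refine fun h => ⟨h.inconsistent, fun f s D hD hb => ?_⟩
    obtain ⟨ψ, rfl⟩ := hD
    obtain ⟨x, hx, hq⟩ := h.consistent f s {ψ} (by simpa [tp] using hb)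
    exact ⟨x, hq ψ (by simp), hx⟩
  · rintro ⟨h₁, h₂⟩
    refine ⟨h₁, fun f s q hq => ?_⟩
    obtain ⟨x, hxD, hx⟩ := h₂ f s {x | ∀ ψ ∈ q, ψ.Realize x}
      (definable_forall_mem_finset q fun ψ => ⟨ψ, rfl⟩) fun ψ hψ => hq hψ
    exact ⟨x, hx, hxD⟩

/-- Patterns in `tp(b/C)` in terms of uniformly definable sequences of sets. -/
theorem hasInpPattern_tp_iff {ι : Type x} {b : ι → M} {κ : Cardinal.{w}} :
    HasInpPattern (tp L b C) κ ↔ ∃ (I : Type w) (X : I → ℕ → Set (ι → M)) (k : I → ℕ), #I = κ ∧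
      (∀ α, UniformlyDefinable L (X α)) ∧
      (∀ (α : I) (s : Finset ℕ), s.card = k α → ¬ ∃ x : ι → M, ∀ i ∈ s, x ∈ X α i) ∧
      ∀ (f : I → ℕ) (s : Finset I) (D : Set (ι → M)), C.Definable L D → b ∈ D →
        ∃ x ∈ D, ∀ α ∈ s, x ∈ X α (f α) := by
  constructor
  · rintro ⟨I, hI, m, φ, k, a, h⟩
    rw [isInpPattern_tp_iff] at h
    exact ⟨I, fun α i => {x | (φ α).Realize (Sum.elim x (a α i))}, k, hI,
      fun α => ⟨m α, φ α, a α, fun i x => Iff.rfl⟩, h⟩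
  · rintro ⟨I, X, k, hI, hX, h⟩
    choose m φ a ha using hX
    refine ⟨I, hI, m, φ, k, a, isInpPattern_tp_iff.2 ?_⟩
    simpa only [ha] using h

/-- Shrinking the set of parameters keeps patterns. -/
theorem HasInpPattern.mono_params {ι : Type x} {b : ι → M} {κ : Cardinal.{w}} {C' : Set M}
    (hC : C ⊆ C') (h : HasInpPattern (tp L b C') κ) : HasInpPattern (tp L b C) κ := by
  rw [hasInpPattern_tp_iff] at h ⊢
  obtain ⟨I, X, k, hI, hX, h₁, h₂⟩ := h
  exact ⟨I, X, k, hI, hX, h₁, fun f s D hD => h₂ f s D (hD.mono hC)⟩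

theorem HasInpPattern.of_le {ι : Type x} {b : ι → M} {κ κ' : Cardinal.{w}} (hκ : κ' ≤ κ)
    (h : HasInpPattern (tp L b C) κ) : HasInpPattern (tp L b C) κ' := by
  classical
  rw [hasInpPattern_tp_iff] at h ⊢
  obtain ⟨I, X, k, hI, hX, h₁, h₂⟩ := h
  rw [← hI, ← mk_out κ'] at hκ
  obtain ⟨g⟩ := hκ
  refine ⟨κ'.out, fun α => X (g α), fun α => k (g α), mk_out κ', fun α => hX _, fun α => h₁ _,
    fun f s D hD hb => ?_⟩
  obtain ⟨x, hxD, hx⟩ := h₂ (Function.extend g f 0) (s.map g) D hD hb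
  refine ⟨x, hxD, fun α hα => ?_⟩
  have := hx (g α) (Finset.mem_map_of_mem g hα)
  rwa [g.injective.extend_apply] at this

/-- Patterns do not depend on the enumeration of the variables. -/
theorem HasInpPattern.comp_equiv {ι ι' : Type x} {b : ι → M} {κ : Cardinal.{w}} (e : ι' ≃ ι)
    (h : HasInpPattern (tp L b C) κ) : HasInpPattern (tp L (b ∘ e) C) κ := by
  rw [hasInpPattern_tp_iff] at h ⊢
  obtain ⟨I, X, k, hI, hX, h₁, h₂⟩ := h
  refine ⟨I, fun α i => {x | x ∘ e.symm ∈ X α i}, k, hI, fun α => ?_, fun α s hs => ?_,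
    fun f s D hD hb => ?_⟩
  · obtain ⟨m, φ, a, ha⟩ := hX α
    refine ⟨m, φ.relabel (Sum.map e.symm id), a, fun i x => ?_⟩
    simp only [Set.mem_ofPred_eq, ha, Formula.realize_relabel, Sum.elim_comp_map, Function.comp_id]
  · rintro ⟨x, hx⟩
    exact h₁ α s hs ⟨x ∘ e.symm, hx⟩
  · obtain ⟨x, hxD, hx⟩ := h₂ f s _ (hD.preimage_comp e) hb
    refine ⟨x ∘ e, hxD, fun α hα => ?_⟩
    simpa [Function.comp_assoc] using hx α hα

/-- A set defined over `C` and `b` is an instance at `b` of a set defined over `C`. -/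
theorem exists_definable_subst {α β : Type*} (b : α → M) {D : Set (β → M)}
    (hD : (Set.range b ∪ C).Definable L D) :
    ∃ E : Set (α ⊕ β → M), C.Definable L E ∧ ∀ y, y ∈ D ↔ Sum.elim b y ∈ E := by
  classical
  obtain ⟨φ, rfl⟩ := Set.definable_iff_exists_formula_sum.1 hD
  have hb : ∀ c : ↥(Set.range b ∪ C), (c : M) ∉ C → ∃ i, b i = c := fun c hc => c.2.resolve_right hc
  choose g hg using hb
  refine ⟨_, Set.definable_iff_exists_formula_sum.2 ⟨φ.relabel (Sum.elim
    (fun c : ↥(Set.range b ∪ C) =>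
      if hc : (c : M) ∈ C then Sum.inl ⟨c, hc⟩ else Sum.inr (Sum.inl (g c hc)))
    (fun y => Sum.inr (Sum.inr y))), rfl⟩, fun y => ?_⟩
  simp only [Set.mem_ofPred_eq, Formula.realize_relabel]
  apply iff_of_eq
  congr 1
  funext s
  rcases s with c | y
  · by_cases hc : (c : M) ∈ C <;> simp [hc, hg]
  · rfl

end Patterns

end Burden

namespace Burden

/-! ### Rows of a grid and consistency of finitely many paths. -/

section Rows

variable {L : FirstOrder.Language.{u, v}} {M : Type w} [L.Structure M] {A C : Set M}
  {ι : Type*} {ι₁ ι₂ : Type*} {R : Type w} {m : R → ℕ}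

/-- The instance of the formula of row `r` at entry `i` of that row of the array `z`. -/
def rowSet (φ : ∀ r, L.Formula (ι ⊕ Fin (m r))) (z : (Σ r, Fin (m r)) × ℕ → M) (r : R) (i : ℕ) :
    Set (ι → M) :=
  {x | (φ r).Realize (Sum.elim x fun j => z (⟨r, j⟩, i))}

/-- The part `x₁` of the variables has, for every path `g` in `G`, an extension to a point of `ψ`
which satisfies the formulas along `g` in the rows in `Q`. -/
def PathsConsistentAt (φ : ∀ r, L.Formula ((ι₁ ⊕ ι₂) ⊕ Fin (m r))) (ψ : Set (ι₁ ⊕ ι₂ → M))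
    (G : Finset (R → ℕ)) (Q : Finset R) (x₁ : ι₁ → M) (z : (Σ r, Fin (m r)) × ℕ → M) : Prop :=
  ∀ g ∈ G, ∃ x₂ : ι₂ → M, Sum.elim x₁ x₂ ∈ ψ ∧ ∀ r ∈ Q, Sum.elim x₁ x₂ ∈ rowSet φ z r (g r)

theorem rowSet_reindex (φ : ∀ r, L.Formula (ι ⊕ Fin (m r))) (z : (Σ r, Fin (m r)) × ℕ → M)
    (v : R → ℕ → ℕ) (r : R) (i : ℕ) :
    rowSet φ (reindex Sigma.fst v z) r i = rowSet φ z r (v r i) :=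
  rfl

theorem definable_mem_rowSet {β : Type*} (φ : ∀ r, L.Formula (ι ⊕ Fin (m r))) (r : R) (i : ℕ)
    (h : ι → β) (h' : (Σ r, Fin (m r)) × ℕ → β) :
    A.Definable L {z : β → M | z ∘ h ∈ rowSet φ (z ∘ h') r i} := by
  convert definable_realize (A := A) (φ r) (Sum.elim h fun j => h' (⟨r, j⟩, i)) using 1
  ext z
  apply iff_of_eq
  simp only [rowSet, Set.mem_ofPred_eq]
  congr 1
  funext s
  rcases s with s | s <;> rfl

theorem definable_pathsConsistentAt [Nonempty M] {β : Type*}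
    (φ : ∀ r, L.Formula ((ι₁ ⊕ ι₂) ⊕ Fin (m r))) {ψ : Set (ι₁ ⊕ ι₂ → M)} (hψ : A.Definable L ψ)
    (G : Finset (R → ℕ)) (Q : Finset R) (h : ι₁ → β) (h' : (Σ r, Fin (m r)) × ℕ → β) :
    A.Definable L {z : β → M | PathsConsistentAt φ ψ G Q (z ∘ h) (z ∘ h')} := by
  have helim : ∀ z : β ⊕ ι₂ → M, Sum.elim ((z ∘ Sum.inl) ∘ h) (z ∘ Sum.inr) =
      z ∘ Sum.elim (Sum.inl ∘ h) Sum.inr := fun z => by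
    rw [Sum.comp_elim]
    rfl
  refine definable_forall_mem_finset G fun g => definable_exists (definable_and ?_ ?_)
  · simp only [helim]
    exact hψ.preimage_comp _
  · refine definable_forall_mem_finset Q fun r => ?_
    simp only [helim]
    exact definable_mem_rowSet φ r (g r) _ (Sum.inl ∘ h')

theorem definable_exists_forall_mem_rowSet [Nonempty M] {β : Type*}
    (φ : ∀ r, L.Formula (ι ⊕ Fin (m r))) (r : R) (s : Finset ℕ)
    (h' : (Σ r, Fin (m r)) × ℕ → β) :
    A.Definable L {z : β → M | ∃ x, ∀ i ∈ s, x ∈ rowSet φ (z ∘ h') r i} :=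
  definable_exists (definable_forall_mem_finset s fun i =>
    definable_mem_rowSet φ r i Sum.inr (Sum.inl ∘ h'))

end Rows

/-- Enumerate `s` increasingly and continue above its maximum. This turns a set of `k` indices into
a reindexing of a whole row whose first `k` entries are those of the set. -/
theorem exists_strictMono_mem_finset (s : Finset ℕ) :
    ∃ u : ℕ → ℕ, StrictMono u ∧ ∀ j < s.card, u j ∈ s := by
  refine ⟨fun j => if h : j < s.card then s.orderEmbOfFin rfl ⟨j, h⟩ else s.sup id + 1 + j,
    fun i j hij => ?_, fun j hj => ?_⟩
  · by_cases hj : j < s.card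
    · have hi : i < s.card := hij.trans hj
      simpa [hi, hj] using hij
    · by_cases hi : i < s.card
      · have : s.orderEmbOfFin rfl ⟨i, hi⟩ ≤ s.sup id :=
          Finset.le_sup (f := id) (Finset.orderEmbOfFin_mem s rfl ⟨i, hi⟩)
        simp only [hi, hj, dif_pos, dif_neg, not_false_eq_true]
        omega
      · simp only [hi, hj, dif_neg, not_false_eq_true]
        omega
  · simp only [hj, dif_pos]
    exact Finset.orderEmbOfFin_mem _ _ _

theorem mk_array_lt {μ : Cardinal.{w}} (hμ : ℵ₀ < μ) {R : Type w} (hR : #R < μ) (m : R → ℕ) :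
    #((Σ r, Fin (m r)) × ℕ) < μ := by
  have h₁ : #(Σ r, Fin (m r)) ≤ #(R × ℕ) :=
    mk_le_of_injective (f := fun e : Σ r, Fin (m r) => (e.1, (e.2 : ℕ))) fun e e' h => by
      rcases e with ⟨r, j⟩
      rcases e' with ⟨r', j'⟩
      simp only [Prod.mk.injEq] at h
      obtain ⟨rfl, h⟩ := h
      rw [Fin.ext h]
  have h₂ : #(R × ℕ) < μ := by
    simpa using mul_lt_of_lt hμ.le hR hμ
  simpa using mul_lt_of_lt hμ.le (h₁.trans_lt h₂) hμ

section Indiscernible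

variable {L : FirstOrder.Language.{u, v}} {M : Type w} [L.Structure M] [Nonempty M]
  {μ : Cardinal.{w}} {C : Set M} {ι₁ ι₂ : Type x} {R : Type w} {m : R → ℕ}

/-- The array of a pattern can be chosen such that the consistency of finitely many paths does not
change when its rows are reindexed. -/
theorem exists_indiscernible_pattern (hM : IsSaturated L M μ) (hμ : ℵ₀ < μ) (hC : #C < μ)
    (hR : #R < μ) {φ : ∀ r, L.Formula ((ι₁ ⊕ ι₂) ⊕ Fin (m r))} {k : R → ℕ}
    {a : ∀ r, ℕ → Fin (m r) → M} {b : ι₁ ⊕ ι₂ → M} (ha : IsInpPattern (tp L b C) φ k a) :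
    ∃ z : (Σ r, Fin (m r)) × ℕ → M,
      (∀ (r : R) (s : Finset ℕ), s.card = k r → ¬ ∃ x, ∀ i ∈ s, x ∈ rowSet φ z r i) ∧
      (∀ (f : R → ℕ) (s : Finset R) (D : Set (ι₁ ⊕ ι₂ → M)), C.Definable L D → b ∈ D →
        ∃ x ∈ D, ∀ r ∈ s, x ∈ rowSet φ z r (f r)) ∧
      ∀ (ψ : Set (ι₁ ⊕ ι₂ → M)), C.Definable L ψ → ∀ (G : Finset (R → ℕ)) (Q : Finset R)
        (v : R → ℕ → ℕ), (∀ r, StrictMono (v r)) →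
        ((∃ x₁, PathsConsistentAt φ ψ G Q x₁ (reindex Sigma.fst v z)) ↔
          ∃ x₁, PathsConsistentAt φ ψ G Q x₁ z) := by
  classical
  obtain ⟨hinc, hcons⟩ := isInpPattern_tp_iff.1 ha
  have hW := mk_array_lt hμ hR m
  let a' : (Σ r, Fin (m r)) × ℕ → M := fun e => a e.1.1 e.2 e.1.2
  have ha' : ∀ v r i, rowSet φ (reindex Sigma.fst v a') r i =
      {x | (φ r).Realize (Sum.elim x (a r (v r i)))} := fun v r i => rfl
  obtain ⟨z, hz, hind⟩ := hM.exists_mutually_indiscernible hμ.le hC hW Sigma.fst a'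
  refine ⟨z, fun r s hs => ?_, fun f s D hD hb => ?_, fun ψ hψ G Q v hv => ?_⟩
  -- Injectivity on the indices in `s` is needed here: the reindexed instances must still be `k r`
  -- distinct members of the row.
  · refine hz {z | ¬ ∃ x, ∀ i ∈ s, x ∈ rowSet φ z r i}
      (definable_not (definable_exists_forall_mem_rowSet φ r s id)) (s.image fun i => (r, i)) ?_
    rintro v hv ⟨x, hx⟩
    refine hinc r (s.image (v r)) ?_ ⟨x, fun i hi => ?_⟩
    · rw [Finset.card_image_of_injOn, hs]
      intro i hi j hj h
      exact hv r i j (Finset.mem_image_of_mem _ hi) (Finset.mem_image_of_mem _ hj) h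
    · obtain ⟨j, hj, rfl⟩ := Finset.mem_image.1 hi
      exact hx j hj
  · refine hz {z | ∃ x, x ∈ D ∧ ∀ r ∈ s, x ∈ rowSet φ z r (f r)}
      (definable_exists (definable_and (hD.preimage_comp Sum.inr)
        (definable_forall_mem_finset s fun r => definable_mem_rowSet φ r (f r) Sum.inr Sum.inl)))
      ∅ fun v _ => ?_
    exact hcons (fun r => v r (f r)) s D hD hb
  · exact hind {z | ∃ x₁, PathsConsistentAt φ ψ G Q x₁ z}
      (definable_exists (definable_pathsConsistentAt φ hψ G Q Sum.inr Sum.inl)) v hv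

end Indiscernible

/-! ### The dichotomy between the two parts of the variables. -/

section Dichotomy

variable {L : FirstOrder.Language.{u, v}} {M : Type w} [L.Structure M] [Nonempty M]
  {μ : Cardinal.{w}} {C : Set M} {ι₁ ι₂ : Type x} {I₁ I₂ : Type w} {m : I₁ × I₂ → ℕ}

/-- Either the formulas of one of the columns of rows yield a pattern in the first part of the
variables, or a row can be selected in every column such that a single value of the first part is
consistent with all paths through the selected rows. -/
theorem hasInpPattern_or_exists_selection {φ : ∀ r, L.Formula ((ι₁ ⊕ ι₂) ⊕ Fin (m r))}
    {b₁ : ι₁ → M} {b₂ : ι₂ → M} {z : (Σ r, Fin (m r)) × ℕ → M}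
    (hcons : ∀ (f : I₁ × I₂ → ℕ) (s : Finset (I₁ × I₂)) (D : Set (ι₁ ⊕ ι₂ → M)),
      C.Definable L D → Sum.elim b₁ b₂ ∈ D → ∃ x ∈ D, ∀ r ∈ s, x ∈ rowSet φ z r (f r))
    (hind : ∀ (ψ : Set (ι₁ ⊕ ι₂ → M)), C.Definable L ψ → ∀ (G : Finset (I₁ × I₂ → ℕ))
      (Q : Finset (I₁ × I₂)) (v : I₁ × I₂ → ℕ → ℕ), (∀ r, StrictMono (v r)) →
        ((∃ x₁, PathsConsistentAt φ ψ G Q x₁ (reindex Sigma.fst v z)) ↔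
          ∃ x₁, PathsConsistentAt φ ψ G Q x₁ z)) :
    HasInpPattern (tp L b₁ C) #I₁ ∨ ∃ c : I₂ → I₁, ∀ ψ : Set (ι₁ ⊕ ι₂ → M), C.Definable L ψ →
      Sum.elim b₁ b₂ ∈ ψ → ∀ (G : Finset (I₁ × I₂ → ℕ)) (Q : Finset (I₁ × I₂)),
        (∀ r ∈ Q, r.1 = c r.2) → ∃ x₁, PathsConsistentAt φ ψ G Q x₁ z := by
  classical
  -- Paths are free on the selected rows, but fixed at entry `0` in the columns without a selected
  -- row. For the empty selection only one path remains, so this is the consistency of the given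
  -- pattern.
  let good : Set (Set (I₁ × I₂)) := {S | (∀ α α' β, (α, β) ∈ S → (α', β) ∈ S → α = α') ∧
    ∀ ψ : Set (ι₁ ⊕ ι₂ → M), C.Definable L ψ → Sum.elim b₁ b₂ ∈ ψ →
      ∀ (G : Finset (I₁ × I₂ → ℕ)) (Q : Finset (I₁ × I₂)),
        (∀ r ∈ Q, r ∈ S ∨ (∀ α, (α, r.2) ∉ S) ∧ ∀ g ∈ G, g r = 0) →
          ∃ x₁, PathsConsistentAt φ ψ G Q x₁ z}
  obtain ⟨S, hS⟩ : ∃ S, Maximal (· ∈ good) S := by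
    refine zorn_subset good fun c hc hchain => ?_
    rcases c.eq_empty_or_nonempty with rfl | hne
    · refine ⟨∅, ⟨by simp, fun ψ hψ hb G Q hQ => ?_⟩, by simp⟩
      obtain ⟨x, hxψ, hx⟩ := hcons 0 Q ψ hψ hb
      refine ⟨x ∘ Sum.inl, fun g hg => ⟨x ∘ Sum.inr, ?_⟩⟩
      rw [Sum.elim_comp_inl_inr]
      refine ⟨hxψ, fun r hr => ?_⟩
      rw [((hQ r hr).resolve_left id).2 g hg]
      exact hx r hr
    · have hdir := hchain.directedOn
      refine ⟨⋃₀ c, ⟨fun α α' β h h' => ?_, fun ψ hψ hb G Q hQ => ?_⟩,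
        fun t ht => Set.subset_sUnion_of_mem ht⟩
      · obtain ⟨t, ht, h⟩ := h
        obtain ⟨t', ht', h'⟩ := h'
        obtain ⟨t'', ht'', hle, hle'⟩ := hdir t ht t' ht'
        exact (hc ht'').1 α α' β (hle h) (hle' h')
      · obtain ⟨t, htc, hKt⟩ := hdir.exists_mem_subset_of_finset_subset_biUnion
          (f := id) hne (s := Q.filter (· ∈ ⋃₀ c)) (by
            intro r hr
            simpa [Set.sUnion_eq_biUnion] using (Finset.mem_filter.1 (Finset.mem_coe.1 hr)).2)
        refine (hc htc).2 ψ hψ hb G Q fun r hr => ?_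
        by_cases hrc : r ∈ ⋃₀ c
        · exact Or.inl (hKt (Finset.mem_coe.2 (Finset.mem_filter.2 ⟨hr, hrc⟩)))
        · obtain ⟨h₁, h₂⟩ := (hQ r hr).resolve_left hrc
          exact Or.inr ⟨fun α hα => h₁ α ⟨t, htc, hα⟩, h₂⟩
  by_cases htot : ∀ β, ∃ α, (α, β) ∈ S
  · right
    choose c hcS using htot
    refine ⟨c, fun ψ hψ hb G Q hQ => hS.prop.2 ψ hψ hb G Q fun r hr => Or.inl ?_⟩
    have := hcS r.2
    rwa [← hQ r hr] at this
  left
  push Not at htot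
  obtain ⟨β, hβ⟩ := htot
  -- Once `(α, β)` is added, column `β` is no longer missed, so `(α, β)` is the only row of that
  -- column which the witness can use.
  have hfail : ∀ α : I₁, ∃ (ψ : Set (ι₁ ⊕ ι₂ → M)) (G : Finset (I₁ × I₂ → ℕ))
      (Q : Finset (I₁ × I₂)), C.Definable L ψ ∧ Sum.elim b₁ b₂ ∈ ψ ∧
      (∀ r ∈ Q, r = (α, β) ∨ r ∈ S ∨ (r.2 ≠ β ∧ ∀ α', (α', r.2) ∉ S) ∧ ∀ g ∈ G, g r = 0) ∧
      ¬ ∃ x₁, PathsConsistentAt φ ψ G Q x₁ z := by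
    intro α
    by_contra hno
    push Not at hno
    refine hβ α (hS.le_of_ge (y := insert (α, β) S) ⟨?_, fun ψ hψ hb G Q hQ => ?_⟩
      (Set.subset_insert _ _) (Set.mem_insert _ _))
    · intro α₁ α₂ β' h₁ h₂
      rcases h₁ with h₁ | h₁ <;> rcases h₂ with h₂ | h₂
      · rw [Prod.mk.injEq] at h₁ h₂
        rw [h₁.1, h₂.1]
      · rw [Prod.mk.injEq] at h₁
        exact (hβ α₂ (h₁.2 ▸ h₂)).elim
      · rw [Prod.mk.injEq] at h₂
        exact (hβ α₁ (h₂.2 ▸ h₁)).elim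
      · exact hS.prop.1 _ _ _ h₁ h₂
    · refine hno ψ G Q hψ hb fun r hr => ?_
      rcases hQ r hr with (h | h) | ⟨h, h'⟩
      · exact Or.inl h
      · exact Or.inr (Or.inl h)
      · refine Or.inr (Or.inr ⟨⟨fun hr => h α (Or.inl (by rw [hr])), fun α' hα' => ?_⟩, h'⟩)
        exact h α' (Or.inr hα')
  choose ψ G Q hψ hb hQ hnot using hfail
  let rowAt (α : I₁) (i : ℕ) : I₁ × I₂ → ℕ → ℕ := fun r j => if r = (α, β) then i else j
  -- Instance `i` pretends that every entry of row `(α, β)` is entry `i`. The bound is one more than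
  -- the largest index at which a path of `G α` meets that row.
  refine hasInpPattern_tp_iff.2 ⟨I₁, fun α i => {x₁ | PathsConsistentAt φ (ψ α) (G α)
    (insert (α, β) (Q α)) x₁ (reindex Sigma.fst (rowAt α i) z)},
    fun α => (G α).sup (fun g => g (α, β)) + 1, rfl, fun α => ?_, fun α s hs => ?_,
    fun f s D hD hbD => ?_⟩
  · exact uniformlyDefinable_of_definable
      (definable_pathsConsistentAt φ (hψ α) (G α) _ Sum.inl Sum.inr) _
  · rintro ⟨x₁, hx₁⟩
    -- Listing the indices in `s` along row `(α, β)` supplies all entries that the paths in `G α`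
    -- use, each with its own `x₂`; indiscernibility then contradicts the choice of `G α`.
    obtain ⟨u, hu, hus⟩ := exists_strictMono_mem_finset s
    refine hnot α ((hind (ψ α) (hψ α) (G α) (Q α) (fun r => if r = (α, β) then u else id)
      fun r => ?_).1 ⟨x₁, fun g hg => ?_⟩)
    · by_cases hr : r = (α, β)
      · simpa [hr] using hu
      · simpa [hr] using strictMono_id
    · have hle : g (α, β) ≤ (G α).sup fun g => g (α, β) :=
        Finset.le_sup (f := fun g : I₁ × I₂ → ℕ => g (α, β)) hg
      obtain ⟨x₂, hxψ, hx⟩ := hx₁ _ (hus (g (α, β)) (hs ▸ Nat.lt_succ_of_le hle)) g hg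
      refine ⟨x₂, hxψ, fun r hr => ?_⟩
      have := hx r (Finset.mem_insert_of_mem hr)
      rw [rowSet_reindex] at this ⊢
      by_cases hr' : r = (α, β)
      · subst hr'
        simpa [rowAt] using this
      · simpa [rowAt, hr'] using this
  -- Setting the paths to `0` off `S` makes goodness of `S` applicable to all witnesses at once.
  -- Shifting each row `(α, β)` by `f α` then turns its entry `0` into entry `f α`. The extra path
  -- `0` ensures `x₁ ∈ D` even if there are no other paths.
  · let res (g : I₁ × I₂ → ℕ) : I₁ × I₂ → ℕ := fun r => if r ∈ S then g r else 0
    have hDψ : C.Definable L {x : ι₁ ⊕ ι₂ → M | x ∘ Sum.inl ∈ D ∧ ∀ α ∈ s, x ∈ ψ α} :=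
      definable_and (hD.preimage_comp Sum.inl) (definable_forall_mem_finset s hψ)
    obtain ⟨x₁, hx₁⟩ := (hind _ hDψ (insert 0 (s.biUnion fun α => (G α).image res))
      (s.biUnion fun α => insert (α, β) (Q α))
      (fun r j => if r.2 = β then j + f r.1 else j) fun r => by
        by_cases hr : r.2 = β
        · simp only [hr, if_true]
          exact strictMono_id.add_const (f r.1)
        · simp only [hr, if_false]
          exact strictMono_id).2 (hS.prop.2 _ hDψ
          ⟨by simpa using hbD, fun α _ => hb α⟩ _ _ fun r hr => by
      by_cases hrS : r ∈ S
      · exact Or.inl hrS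
      · refine Or.inr ⟨?_, fun g hg => ?_⟩
        · obtain ⟨α, hα, hr⟩ := Finset.mem_biUnion.1 hr
          rcases Finset.mem_insert.1 hr with rfl | hr
          · exact hβ
          · rcases hQ α r hr with rfl | h | h
            · exact hβ
            · exact (hrS h).elim
            · exact h.1.2
        · rcases Finset.mem_insert.1 hg with rfl | hg
          · rfl
          · obtain ⟨α, -, hg⟩ := Finset.mem_biUnion.1 hg
            obtain ⟨g', -, rfl⟩ := Finset.mem_image.1 hg
            simp [res, hrS])
    refine ⟨x₁, ?_, fun α hα g hg => ?_⟩
    · obtain ⟨x₂, hx₂, -⟩ := hx₁ 0 (Finset.mem_insert_self _ _)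
      simpa using hx₂.1
    · obtain ⟨x₂, hxψ, hx⟩ := hx₁ (res g) (Finset.mem_insert_of_mem
        (Finset.mem_biUnion.2 ⟨α, hα, Finset.mem_image_of_mem _ hg⟩))
      refine ⟨x₂, hxψ.2 α hα, fun r hr => ?_⟩
      have h := hx r (Finset.mem_biUnion.2 ⟨α, hα, hr⟩)
      rw [rowSet_reindex] at h ⊢
      by_cases hr' : r = (α, β)
      · subst hr'
        simpa [rowAt, res, hβ α] using h
      · have hrQ := hQ α r ((Finset.mem_insert.1 hr).resolve_left hr')
        rcases hrQ with hrQ | hrQ | ⟨⟨hrβ, hrS⟩, h0⟩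
        · exact (hr' hrQ).elim
        · have hrβ : r.2 ≠ β := fun e => hβ r.1 (e ▸ hrQ)
          simpa [rowAt, res, hr', hrβ, hrQ] using h
        · have hrS' : r ∉ S := hrS r.1
          simpa [rowAt, res, hr', hrβ, hrS', h0 g hg] using h

/-- A selection of rows as in `hasInpPattern_or_exists_selection` yields a pattern in the second
part of the variables over the first part. -/
theorem hasInpPattern_of_selection (hM : IsSaturated L M μ) (hμ : ℵ₀ ≤ μ)
    {φ : ∀ r, L.Formula ((ι₁ ⊕ ι₂) ⊕ Fin (m r))} {k : I₁ × I₂ → ℕ}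
    {b₁ : ι₁ → M} {b₂ : ι₂ → M} (hbC : #↥(Set.range b₁ ∪ C) < μ)
    (hV : #((Σ r, Fin (m r)) × ℕ) < μ) {z : (Σ r, Fin (m r)) × ℕ → M}
    (hinc : ∀ r (s : Finset ℕ), s.card = k r → ¬ ∃ x, ∀ i ∈ s, x ∈ rowSet φ z r i)
    (c : I₂ → I₁) (hc : ∀ ψ : Set (ι₁ ⊕ ι₂ → M), C.Definable L ψ → Sum.elim b₁ b₂ ∈ ψ →
      ∀ (G : Finset (I₁ × I₂ → ℕ)) (Q : Finset (I₁ × I₂)), (∀ r ∈ Q, r.1 = c r.2) →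
        ∃ x₁, PathsConsistentAt φ ψ G Q x₁ z) :
    HasInpPattern (tp L b₂ (Set.range b₁ ∪ C)) #I₂ := by
  classical
  let J := {ψ : Set (ι₁ ⊕ ι₂ → M) // C.Definable L ψ ∧ Sum.elim b₁ b₂ ∈ ψ} ×
    (I₁ × I₂ → ℕ) × Finset I₂ × Finset ℕ
  let rows (F : Finset I₂) : Finset (I₁ × I₂) := F.image fun β => (c β, β)
  let P (j : J) (x₁ : ι₁ → M) (z : (Σ r, Fin (m r)) × ℕ → M) : Prop :=
    PathsConsistentAt φ j.1.1 {j.2.1} (rows j.2.2.1) x₁ z ∧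
      ∀ r ∈ (rows j.2.2.1).filter fun r => j.2.2.2.card = k r,
        ¬ ∃ x, ∀ i ∈ j.2.2.2, x ∈ rowSet φ z r i
  have hP : ∀ (j : J) {β : Type (max w x)} (h : ι₁ → β) (h' : (Σ r, Fin (m r)) × ℕ → β),
      C.Definable L {y : β → M | P j (y ∘ h) (y ∘ h')} := fun j β h h' =>
    definable_and (definable_pathsConsistentAt φ j.1.2.1 _ _ h h')
      (definable_forall_mem_finset _ fun r =>
        definable_not (definable_exists_forall_mem_rowSet φ r _ h'))
  obtain ⟨z', hz'⟩ := hM.exists_forall_mem hμ hbC hV (fun j : J => {z | P j b₁ z})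
    (fun j => definable_subst b₁ (hP j Sum.inl Sum.inr)) (by
      intro t
      by_contra hno
      -- If no array suits `b₁`, this is a `C`-definable property of `b₁`, so it may be imposed on
      -- the `x₁` provided by `hc`; but `z` itself suits that `x₁`.
      let E : Set (ι₁ → M) := {x₁ | ¬ ∃ z, ∀ j ∈ t, P j x₁ z}
      have hE : C.Definable L E :=
        definable_not (definable_exists (definable_forall_mem_finset t fun j =>
          hP j Sum.inl Sum.inr))
      obtain ⟨x₁, hx₁⟩ := hc {x | x ∘ Sum.inl ∈ E ∧ ∀ j ∈ t, x ∈ j.1.1}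
        (definable_and (hE.preimage_comp Sum.inl)
          (definable_forall_mem_finset t fun j => j.1.2.1))
        ⟨by simpa [E] using hno, fun j _ => j.1.2.2⟩ (insert 0 (t.image fun j => j.2.1))
        (rows (t.biUnion fun j => j.2.2.1)) (fun r hr => by
          obtain ⟨β, -, rfl⟩ := Finset.mem_image.1 hr
          rfl)
      obtain ⟨x₂, hx₂, -⟩ := hx₁ 0 (Finset.mem_insert_self _ _)
      have hx₁E : x₁ ∈ E := by simpa using hx₂.1
      refine hx₁E ⟨z, fun j hj => ⟨fun g hg => ?_, fun r hr => hinc r _ (Finset.mem_filter.1 hr).2⟩⟩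
      obtain rfl := Finset.mem_singleton.1 hg
      obtain ⟨x₂, hxψ, hx⟩ := hx₁ j.2.1
        (Finset.mem_insert_of_mem (Finset.mem_image_of_mem (fun j : J => j.2.1) hj))
      refine ⟨x₂, hxψ.2 j hj, fun r hr => hx r ?_⟩
      exact Finset.image_subset_image (Finset.subset_biUnion_of_mem (fun j : J => j.2.2.1) hj) hr)
  refine hasInpPattern_tp_iff.2 ⟨I₂, fun β i => {x₂ | Sum.elim b₁ x₂ ∈ rowSet φ z' (c β, β) i},
    fun β => k (c β, β), rfl, fun β => ?_, fun β s hs => ?_, fun f s D hD hbD => ?_⟩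
  -- Repeating entry `i` along the row makes `i` vary only in the parameters, with the formula fixed
  -- at entry `0`.
  · have := uniformlyDefinable_of_definable (L := L) (A := C)
      (P := fun (x₂ : ι₂ → M) (y : ι₁ ⊕ ((Σ r, Fin (m r)) × ℕ) → M) =>
        Sum.elim (y ∘ Sum.inl) x₂ ∈ rowSet φ (y ∘ Sum.inr) (c β, β) 0) (by
          have h := definable_mem_rowSet (A := C) φ (c β, β) 0
            (Sum.elim (Sum.inr ∘ Sum.inl) Sum.inl : ι₁ ⊕ ι₂ → ι₂ ⊕ ι₁ ⊕ ((Σ r, Fin (m r)) × ℕ))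
            (Sum.inr ∘ Sum.inr)
          simp only [Sum.comp_elim] at h
          exact h)
      (fun i => Sum.elim b₁ (reindex Sigma.fst (fun _ _ => i) z'))
    simpa only [Sum.elim_comp_inl, Sum.elim_comp_inr, rowSet_reindex] using this
  · rintro ⟨x₂, hx₂⟩
    refine (hz' (⟨Set.univ, Set.definable_univ, trivial⟩, 0, {β}, s)).2 (c β, β) ?_
      ⟨Sum.elim b₁ x₂, hx₂⟩
    simpa [rows] using hs
  · obtain ⟨ψ, hψ, hDψ⟩ := exists_definable_subst b₁ hD
    obtain ⟨x₂, hxψ, hx⟩ := (hz' (⟨ψ, hψ, (hDψ b₂).1 hbD⟩, fun r => f r.2, s, ∅)).1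
      (fun r => f r.2) (Finset.mem_singleton_self _)
    exact ⟨x₂, (hDψ x₂).2 hxψ, fun β hβ =>
      hx (c β, β) (Finset.mem_image_of_mem (fun β => (c β, β)) hβ)⟩

end Dichotomy

end Burden

/-! ### The product bound and sub-multiplicativity of burden. -/

namespace Burden

variable {L : FirstOrder.Language.{u, v}} {M : Type w} [L.Structure M] {μ : Cardinal.{w}}
  {C : Set M}

/-- A pattern of depth `κ₁ * κ₂` in `tp(b₁b₂/C)` yields one of depth `κ₁` in `tp(b₁/C)` or one of
depth `κ₂` in `tp(b₂/b₁C)`. -/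
theorem hasInpPattern_or_of_mul [Nonempty M] (hM : IsSaturated L M μ) (hμ : ℵ₀ < μ)
    (hC : #C < μ) {ι₁ ι₂ : Type x} (hι₁ : lift.{w} #ι₁ < lift.{x} μ) {b₁ : ι₁ → M} {b₂ : ι₂ → M}
    {κ₁ κ₂ : Cardinal.{w}} (hκ₁ : κ₁ < μ) (hκ₂ : κ₂ < μ)
    (h : HasInpPattern (tp L (Sum.elim b₁ b₂) C) (κ₁ * κ₂)) :
    HasInpPattern (tp L b₁ C) κ₁ ∨ HasInpPattern (tp L b₂ (Set.range b₁ ∪ C)) κ₂ := by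
  have h' : ∃ (m : κ₁.out × κ₂.out → ℕ) (φ : ∀ r, L.Formula ((ι₁ ⊕ ι₂) ⊕ Fin (m r)))
      (k : κ₁.out × κ₂.out → ℕ) (a : ∀ r, ℕ → Fin (m r) → M),
      IsInpPattern (tp L (Sum.elim b₁ b₂) C) φ k a := by
    obtain ⟨I, hI, m, φ, k, a, h⟩ := h
    have hI' : #I = #(κ₁.out × κ₂.out) := by simp [hI]
    obtain ⟨e⟩ := Cardinal.eq.1 hI'
    rw [isInpPattern_tp_iff] at h
    refine ⟨fun r => m (e.symm r), fun r => φ (e.symm r), fun r => k (e.symm r),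
      fun r => a (e.symm r), isInpPattern_tp_iff.2 ⟨fun r => h.1 _, fun f s D hD hb => ?_⟩⟩
    obtain ⟨x, hxD, hx⟩ := h.2 (f ∘ e) (s.map e.symm.toEmbedding) D hD hb
    refine ⟨x, hxD, fun r hr => ?_⟩
    simpa using hx (e.symm r) (Finset.mem_map_of_mem e.symm.toEmbedding hr)
  obtain ⟨m, φ, k, a, ha⟩ := h'
  have hR : #(κ₁.out × κ₂.out) < μ := by
    simpa using mul_lt_of_lt hμ.le hκ₁ hκ₂
  obtain ⟨z, hinc, hcons, hind⟩ := exists_indiscernible_pattern hM hμ hC hR ha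
  rcases hasInpPattern_or_exists_selection hcons hind with h₁ | ⟨c, hc⟩
  · left
    rwa [mk_out] at h₁
  · right
    have hb : #(Set.range b₁) < μ := by
      have := (mk_range_le_lift (f := b₁)).trans_lt hι₁
      rwa [lift_lt] at this
    have hbC : #↥(Set.range b₁ ∪ C) < μ :=
      (mk_union_le _ _).trans_lt (add_lt_of_lt hμ.le hb hC)
    have := hasInpPattern_of_selection hM hμ.le hbC (mk_array_lt hμ hR m) hinc c hc
    rwa [mk_out] at this

theorem hasInpPattern_tp_zero {ι : Type x} (b : ι → M) : HasInpPattern (tp L b C) 0 :=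
  hasInpPattern_tp_iff.2 ⟨PEmpty, PEmpty.elim, PEmpty.elim, by simp, fun α => α.elim,
    fun α => α.elim, fun _ _ _ _ hb => ⟨b, hb, fun α => α.elim⟩⟩

/-- The depths of patterns are closed downwards, so without depth `n + 1` all depths are at most
`n`. For `k = 0` both sides fail, because the empty pattern always exists. -/
theorem bdn_tp_lt_iff {ι : Type x} (b : ι → M) (k : ℕ) :
    bdn (tp L b C) < (k : WithTop Cardinal.{w}) ↔ ¬ HasInpPattern (tp L b C) k := by
  constructor
  · intro h hk
    have hle : (k : WithTop Cardinal.{w}) ≤ bdn (tp L b C) :=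
      le_sSup ⟨(k : Cardinal.{w}), hk, by simp⟩
    exact hle.not_gt h
  · intro h
    cases k with
    | zero => exact (h (by simpa using hasInpPattern_tp_zero b)).elim
    | succ n =>
      refine lt_of_le_of_lt (b := ((n : Cardinal.{w}) : WithTop Cardinal.{w})) (sSup_le ?_) ?_
      · rintro _ ⟨κ, hκ, rfl⟩
        rw [WithTop.coe_le_coe]
        by_contra hlt
        refine h (hκ.of_le ?_)
        rw [not_le] at hlt
        have := Order.succ_le_of_lt hlt
        rwa [Nat.cast_succ, ← Cardinal.succ_natCast]
      · have : ((n : Cardinal.{w}) : WithTop Cardinal.{w}) <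
            (((n + 1 : ℕ) : Cardinal.{w}) : WithTop Cardinal.{w}) :=
          WithTop.coe_lt_coe.2 (by exact_mod_cast Nat.lt_succ_self n)
        simpa using this

/-- There is only one empty tuple, so it satisfies every instance of a row and the row cannot be
`k`-inconsistent. This is the empty product in the induction below. -/
theorem not_hasInpPattern_one_of_isEmpty {ι : Type x} [IsEmpty ι] (b : ι → M) :
    ¬ HasInpPattern (tp L b C) 1 := by
  rw [hasInpPattern_tp_iff]
  rintro ⟨I, X, k, hI, -, h₁, h₂⟩
  obtain ⟨α⟩ : Nonempty I := mk_ne_zero_iff.1 (by simp [hI])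
  refine h₁ α (Finset.range (k α)) (by simp) ⟨b, fun i _ => ?_⟩
  obtain ⟨x, -, hx⟩ := h₂ (fun _ => i) {α} Set.univ Set.definable_univ trivial
  rw [Subsingleton.elim b x]
  exact hx α (by simp)

/-- Split off the first tuple: a pattern in the remaining ones over `a 0` and `C` is also a pattern
over `C`, where the induction hypothesis applies. -/
theorem not_hasInpPattern_sigma [Nonempty M] (hM : IsSaturated L M μ) (hμ : ℵ₀ < μ) (hC : #C < μ)
    (n : ℕ) (ι : Fin n → Type x) (hι : ∀ i, lift.{w} #(ι i) < lift.{x} μ) (a : ∀ i, ι i → M)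
    (k : Fin n → ℕ) (h : ∀ i, ¬ HasInpPattern (tp L (a i) C) (k i)) :
    ¬ HasInpPattern (tp L (fun j : Σ i, ι i => a j.1 j.2) C) ((∏ i, k i : ℕ) : Cardinal.{w}) := by
  induction n with
  | zero => simpa using not_hasInpPattern_one_of_isEmpty fun j : Σ i, ι i => a j.1 j.2
  | succ n ih =>
    intro hpat
    let e : ι 0 ⊕ (Σ i : Fin n, ι i.succ) ≃ Σ i, ι i :=
      { toFun := Sum.elim (fun j => ⟨0, j⟩) fun j => ⟨j.1.succ, j.2⟩
        invFun := fun j => Fin.cases (motive := fun i => ι i → ι 0 ⊕ Σ i : Fin n, ι i.succ)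
          Sum.inl (fun i j => Sum.inr ⟨i, j⟩) j.1 j.2
        left_inv := by rintro (j | ⟨i, j⟩) <;> rfl
        right_inv := by
          rintro ⟨i, j⟩
          induction i using Fin.cases <;> rfl }
    have he : (fun j : Σ i, ι i => a j.1 j.2) ∘ e =
        Sum.elim (a 0) fun j : Σ i : Fin n, ι i.succ => a j.1.succ j.2 := by
      funext j
      rcases j with j | j <;> rfl
    have h' := hpat.comp_equiv e
    rw [he, Fin.prod_univ_succ, Nat.cast_mul] at h'
    rcases hasInpPattern_or_of_mul hM hμ hC (hι 0) (natCast_lt_aleph0.trans hμ)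
      (natCast_lt_aleph0.trans hμ) h' with h₁ | h₂
    · exact h 0 h₁
    · exact ih (fun i => ι i.succ) (fun i => hι _) (fun i => a i.succ) (fun i => k i.succ)
        (fun i => h _) (h₂.mono_params Set.subset_union_right)

end Burden

theorem mainTheorem1 (L : FirstOrder.Language.{u, v}) (M : Type w) [L.Structure M] [Nonempty M]
    (μ : Cardinal.{w}) (hμ : ℵ₀ < μ) (hM : Burden.IsSaturated L M μ)
    (C : Set M) (hC : #C < μ) :
    (∀ (ι₁ ι₂ : Type x), lift.{w} #ι₁ < lift.{x} μ → lift.{w} #ι₂ < lift.{x} μ →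
      ∀ (b₁ : ι₁ → M) (b₂ : ι₂ → M) (κ₁ κ₂ : Cardinal.{w}), κ₁ < μ → κ₂ < μ →
        Burden.HasInpPattern (Burden.tp L (Sum.elim b₁ b₂) C) (κ₁ * κ₂) →
        Burden.HasInpPattern (Burden.tp L b₁ C) κ₁ ∨
          Burden.HasInpPattern (Burden.tp L b₂ (Set.range b₁ ∪ C)) κ₂) ∧
    (∀ (n : ℕ) (ι : Fin n → Type x), (∀ i, lift.{w} #(ι i) < lift.{x} μ) →
      ∀ (a : ∀ i, ι i → M) (k : Fin n → ℕ),
        (∀ i, Burden.bdn (Burden.tp L (a i) C) < (k i : WithTop Cardinal.{w})) →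
        Burden.bdn (Burden.tp L (fun j : Σ i, ι i => a j.1 j.2) C) <
          ((∏ i, k i : ℕ) : WithTop Cardinal.{w})) := by
  refine ⟨fun ι₁ ι₂ hι₁ _ b₁ b₂ κ₁ κ₂ hκ₁ hκ₂ h =>
    Burden.hasInpPattern_or_of_mul hM hμ hC hι₁ hκ₁ hκ₂ h, fun n ι hι a k h => ?_⟩
  rw [Burden.bdn_tp_lt_iff]
  exact Burden.not_hasInpPattern_sigma hM hμ hC n ι hι a k
    fun i => (Burden.bdn_tp_lt_iff (a i) (k i)).1 (h i)
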